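/- Let \(p\) be a prime and let \(G\) be a finite metabelian \(p\)-group whose abelianization \(G/G'\) is of type \((p,p)\), i.e. \(G/G'\simeq \mathbb{Z}/p\times\mathbb{Z}/p\). Write \(|G|=p^n\), let \(c=\mathrm{cl}(G)\) be the nilpotency class and \(\mathrm{cc}(G)=n-c\) the coclass of \(G\). 1. If \(\mathrm{cc}(G)\ge 2\) and \(\mathrm{cl}(G)=3\), then \(p\ge 3\) is odd and \(\mathrm{cc}(G)=2\). 2. If \(\mathrm{cc}(G)=1\) and \(\mathrm{cl}(G)=2\), then \(G\) is an extraspecial \(p\)-group of order \(p^3\) and of exponent \(p\) or \(p^2\). In both cases, \(G\) has exactly \(p+1\) maximal subgroups. Let \(U_1,\ldots,U_{p+1}\) be these subgroups in any order, and let \(\pi:G\to\pi(G)=G/\gamma_c(G)\) be the projection onto the parent, where \(\gamma_c(G)\) is the last non-trivial term of the lower central series. Then there is a total polarization and no stabilization of the Artin pattern on the maximal subgroups: \[\mathrm{Pol}_\pi(G):=\{1\le i\le p+1\mid \ker(\pi)\not\le U_i'\}=\{1,\ldots,p+1\},\qquad \mathrm{Stb}_\pi(G):=\{1\le i\le p+1\mid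 \ker(\pi)\le U_i'\}=\emptyset.\] Accordingly, for every \(i\), with \(V_i=\pi(U_i)\): the transfer target \(V_i/V_i'\) is isomorphic to the quotient of \(U_i/U_i'\) by the kernel of the epimorphism \(U_i/U_i'\to V_i/V_i'\) induced by \(\pi\), but is not isomorphic to \(U_i/U_i'\); and the kernels of the Artin transfers \(T_{G,U_i}:G\to U_i/U_i'\) and \(T_{\pi(G),V_i}:\pi(G)\to V_i/V_i'\) satisfy \(\pi(\ker T_{G,U_i})\le\ker T_{\pi(G),V_i}\). -/

import Mathlib

universe u v w

/-- `G` is metabelian: its second derived subgroup is trivial. -/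
def IsMetabelian (G : Type u) [Group G] : Prop :=
  derivedSeries G 2 = ⊥

/-- The abelianization `G / G'` is of type `(p, p)`. -/
def HasAbelianizationTypePP (p : ℕ) (G : Type u) [Group G] : Prop :=
  Nonempty (Abelianization G ≃* Multiplicative (ZMod p) × Multiplicative (ZMod p))

/-- The coclass `cc(G) = n - cl(G)` of a finite `p`-group `G` of order `p ^ n`. -/
noncomputable def coclass (p : ℕ) (G : Type u) [Group G] : ℤ :=
  (padicValNat p (Nat.card G) : ℤ) - (Group.nilpotencyClass G : ℤ)

/-- An extraspecial `p`-group: a finite `p`-group whose centre has order `p` and coincides both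
with the commutator subgroup and with the Frattini subgroup. -/
structure IsExtraspecial (p : ℕ) (G : Type u) [Group G] : Prop where
  finite : Finite G
  isPGroup : IsPGroup p G
  card_center : Nat.card (Subgroup.center G) = p
  commutator_eq : commutator G = Subgroup.center G
  frattini_eq : frattini G = Subgroup.center G

/-- The last non-trivial term `γ_c(G)`, `c = cl(G)`, of the lower central series of a non-trivial
nilpotent group `G`. Mathlib's series starts with index `0`, that is
`γ_j(G) = lowerCentralSeries ⊤ (j - 1)`. -/
noncomputable def lastLowerCentral (G : Type u) [Group G] : Subgroup G :=
  (⊤ : Subgroup G).lowerCentralSeries (Group.nilpotencyClass G - 1)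

instance lastLowerCentral_normal (G : Type u) [Group G] : (lastLowerCentral G).Normal := by
  unfold lastLowerCentral; infer_instance

/-- The parent `π(G) = G / γ_c(G)`, `c = cl(G)`. -/
abbrev Parent (G : Type u) [Group G] : Type u := G ⧸ lastLowerCentral G

/-- The parent projection `π : G → π(G)`. -/
noncomputable def parentProjection (G : Type u) [Group G] : G →* Parent G :=
  QuotientGroup.mk' (lastLowerCentral G)

section ArtinPattern

variable {G : Type u} [Group G] {H : Type v} [Group H]

/-- The transfer target `U / U'`, the component of the transfer target type `τ(G)` at `U`. -/
abbrev TransferTarget (U : Subgroup G) : Type u := Abelianization U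

/-- The Artin transfer `T_{G,U} : G → U / U'`. -/
noncomputable def artinTransfer (U : Subgroup G) [U.FiniteIndex] : G →* TransferTarget U :=
  MonoidHom.transfer (Abelianization.of : U →* Abelianization U)

/-- The transfer kernel `ker T_{G,U}`, the component of the transfer kernel type `ϰ(G)` at `U`. -/
noncomputable def transferKernel (U : Subgroup G) [U.FiniteIndex] : Subgroup G :=
  (artinTransfer U).ker

/-- The epimorphism `U / U' → V / V'`, `V = φ(U)`, induced by `φ : G → H`. -/
def inducedTargetMap (φ : G →* H) (U : Subgroup G) :
    TransferTarget U →* TransferTarget (U.map φ) :=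
  Abelianization.map (φ.subgroupMap U)

/-- Precedence `V / V' ≼ U / U'` of transfer targets with respect to `φ`, where `V = φ(U)`. -/
def TargetPrecedes (φ : G →* H) (U : Subgroup G) : Prop :=
  Nonempty (TransferTarget (U.map φ) ≃* TransferTarget U ⧸ (inducedTargetMap φ U).ker)

/-- Strict precedence `V / V' ≺ U / U'`: precedence between non-isomorphic targets. -/
def TargetStrictlyPrecedes (φ : G →* H) (U : Subgroup G) : Prop :=
  TargetPrecedes φ U ∧ ¬ Nonempty (TransferTarget (U.map φ) ≃* TransferTarget U)

/-- Precedence `ker T_{G,U} ≼ ker T_{H,V}` of transfer kernels with respect to `φ`,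
where `V = φ(U)`. -/
def KernelPrecedes (φ : G →* H) (U : Subgroup G) [U.FiniteIndex] [(U.map φ).FiniteIndex] : Prop :=
  (transferKernel U).map φ ≤ transferKernel (U.map φ)

/-- The stable part `Stb_φ(G)` of the Artin pattern with respect to `φ`, for a family `(U_i)`. -/
def stablePart {ι : Type w} (φ : G →* H) (U : ι → Subgroup G) : Set ι :=
  {i | φ.ker ≤ ⁅U i, U i⁆}

/-- The polarized part `Pol_φ(G)` of the Artin pattern with respect to `φ`, for a family `(U_i)`. -/
def polarizedPart {ι : Type w} (φ : G →* H) (U : ι → Subgroup G) : Set ι :=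
  {i | ¬ φ.ker ≤ ⁅U i, U i⁆}

/-- `(U_i)` is an enumeration without repetition of all maximal subgroups of `G`. -/
def EnumeratesMaximal {ι : Type w} (U : ι → Subgroup G) : Prop :=
  Function.Injective U ∧ Set.range U = {M : Subgroup G | IsCoatom M}

end ArtinPattern

section Preliminaries

open Subgroup
open scoped commutatorElement

/-! ### Commutators of generated subgroups, orders, maximal subgroups of `p`-groups. -/

section Generalities

variable {G : Type u} [Group G]

/-! Write G = ⟨x, y⟩, s = [x, y], γ₂ = G', γ₃ = [G', G]. Everything reduces to comparing the order
of the last lower central term with that of U' for U maximal (`lastLowerCentral_bounds`).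

In class 3, γ₃ is central and generated by [s, x] and [s, y]. Since [s, g]^p = [s, g^p] lies in G''
= 1, |γ₃| ≤ p²; also |γ₂ : γ₃| ≤ p, so |G| ≤ p⁵. Coclass at least 2 means |G| ≥ p⁵, so equality
holds throughout and |γ₃| = p². A maximal U is ⟨t⟩G', so U' ≤ ⟨[s, t]⟩ has order at most p and
cannot contain γ₃. For p = 2, expanding [x², y] and [x, y²] shows |γ₃| ≤ 2, which is incompatible
with |γ₃| = p².

In class 2 with coclass 1, |G| = p³, so each U has order p² and is abelian, while ker π = G' has
order p.

Once ker π lies in U but not in U', the induced epimorphism of finite targets is not injective, so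
the targets have different orders. The relation of kernels is naturality of the transfer
(`artinTransfer_map`). -/

theorem commutator_closure_closure_le {A B : Set G} {N : Subgroup G} [N.Normal]
    (h : ∀ a ∈ A, ∀ b ∈ B, ⁅a, b⁆ ∈ N) : ⁅closure A, closure B⁆ ≤ N := by
  have key : ∀ a b : G, ⁅a, b⁆ ∈ N ↔ Commute (a : G ⧸ N) (b : G ⧸ N) := fun a b => by
    rw [← commutatorElement_eq_one_iff_commute, ← QuotientGroup.eq_one_iff]; rfl
  -- Extend one argument at a time: centralizers in the quotient by N are subgroups.
  have h1 : ∀ a ∈ A, ∀ b ∈ closure B, ⁅a, b⁆ ∈ N := by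
    intro a ha b hb
    rw [key]
    have : closure B ≤ (centralizer {(a : G ⧸ N)}).comap (QuotientGroup.mk' N) := by
      rw [closure_le]
      intro b hb
      have := (key a b).1 (h a ha b hb)
      simpa [mem_centralizer_singleton_iff] using this.eq.symm
    have := this hb
    rw [mem_comap, mem_centralizer_singleton_iff] at this
    exact Eq.symm this
  rw [commutator_le]
  intro a ha b hb
  rw [key]
  have : closure A ≤ (centralizer {(b : G ⧸ N)}).comap (QuotientGroup.mk' N) := by
    rw [closure_le]
    intro a ha
    have := (key a b).1 (h1 a ha b hb)
    simpa [mem_centralizer_singleton_iff] using this.eq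
  have := this ha
  rw [mem_comap, mem_centralizer_singleton_iff] at this
  exact this

theorem relIndex_mul_card_of_le {H K : Subgroup G} (h : H ≤ K) :
    H.relIndex K * Nat.card H = Nat.card K := by
  rw [← relIndex_bot_left, ← relIndex_bot_left, mul_comm, relIndex_mul_relIndex _ _ _ bot_le h]

theorem card_zpowers_sup_le [Finite G] {N : Subgroup G} [N.Normal] {s : G} {n : ℕ} (hn : 0 < n)
    (hs : s ^ n ∈ N) : Nat.card (zpowers s ⊔ N : Subgroup G) ≤ n * Nat.card N := by
  rw [← relIndex_mul_card_of_le (le_sup_right : N ≤ zpowers s ⊔ N), relIndex_sup_right]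
  refine Nat.mul_le_mul_right _ (Nat.le_of_dvd hn ?_)
  have h := relIndex_ker (K := zpowers s) (QuotientGroup.mk' N)
  rw [QuotientGroup.ker_mk'] at h
  rw [h, MonoidHom.map_zpowers, Nat.card_zpowers]
  exact orderOf_dvd_of_pow_eq_one (by rwa [← map_pow, QuotientGroup.mk'_apply,
    QuotientGroup.eq_one_iff])

theorem commutatorElement_pow_right {s x : G} (h : Commute ⁅s, x⁆ x) (n : ℕ) :
    ⁅s, x ^ n⁆ = ⁅s, x⁆ ^ n := by
  have h1 : s * x * s⁻¹ = ⁅s, x⁆ * x := by simp [commutatorElement_def]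
  have h2 : s * x ^ n * s⁻¹ = ⁅s, x⁆ ^ n * x ^ n := by
    rw [← h.mul_pow, ← h1, conj_pow]
  rw [commutatorElement_def, h2, mul_inv_cancel_right]

theorem index_eq_of_isCoatom {p : ℕ} [Fact p.Prime] [Finite G] (hp : IsPGroup p G)
    {M : Subgroup G} (hM : IsCoatom M) : M.index = p := by
  obtain ⟨n, hn⟩ := IsPGroup.iff_card.1 hp
  obtain ⟨k, hk⟩ := IsPGroup.iff_card.1 (hp.to_subgroup M)
  have hpp : 1 < p := (Fact.out : p.Prime).one_lt
  have hkn : k < n := by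
    refine lt_of_le_of_ne ?_ ?_
    · have := M.card_subgroup_dvd_card
      rw [hn, hk] at this
      exact (Nat.pow_dvd_pow_iff_le_right hpp).1 this
    · rintro rfl
      exact hM.1 (M.eq_top_of_card_eq (hk.trans hn.symm))
  obtain ⟨K, hK, hMK⟩ := Sylow.exists_subgroup_card_pow_succ
    (hn ▸ pow_dvd_pow p hkn) hk
  have : K = ⊤ := hM.2 K (lt_of_le_of_ne hMK (by
    rintro rfl
    have := Nat.pow_right_injective hpp (hk.symm.trans hK)
    omega))
  subst this
  have h := M.index_mul_card
  rw [← card_top (G := G), hK, hk, pow_succ, mul_comm] at h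
  exact Nat.eq_of_mul_eq_mul_left (pow_pos (by omega) k) h

theorem commutator_le_of_isCoatom {p : ℕ} [Fact p.Prime] [Finite G] (hp : IsPGroup p G)
    {M : Subgroup G} (hM : IsCoatom M) : commutator G ≤ M := by
  have := hp.isNilpotent
  have hN : M.Normal := Subgroup.NormalizerCondition.normal_of_coatom M
    (Group.normalizerCondition_of_isNilpotent) hM
  have hc : Nat.card (G ⧸ M) = p := index_eq_of_isCoatom hp hM
  have := isCyclic_of_prime_card hc
  rw [← Subgroup.Normal.quotient_commutative_iff_commutator_le]
  exact IsCyclic.isMulCommutative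

end Generalities

/-! ### Abelianization of type (p, p): generators, maximal subgroups, Frattini subgroup. -/

section TypePP

variable {p : ℕ} {G : Type u} [Group G]

theorem HasAbelianizationTypePP.exists_hom (h : HasAbelianizationTypePP p G) :
    ∃ f : G →* Multiplicative (ZMod p × ZMod p),
      Function.Surjective f ∧ f.ker = commutator G := by
  obtain ⟨e⟩ := h
  let e' : Abelianization G ≃* Multiplicative (ZMod p × ZMod p) :=
    e.trans (MulEquiv.prodMultiplicative (ZMod p) (ZMod p)).symm
  refine ⟨e'.toMonoidHom.comp Abelianization.of, ?_, ?_⟩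
  · exact e'.surjective.comp (QuotientGroup.mk'_surjective _)
  · rw [← Abelianization.ker_of]
    exact MonoidHom.ker_mulEquiv_comp Abelianization.of e'

theorem HasAbelianizationTypePP.index_commutator (h : HasAbelianizationTypePP p G) :
    (commutator G).index = p ^ 2 := by
  obtain ⟨f, hf, hk⟩ := h.exists_hom
  rw [← hk, index_ker, MonoidHom.range_eq_top.2 hf, card_top]
  have : Nat.card (Multiplicative (ZMod p × ZMod p)) = Nat.card (ZMod p × ZMod p) := rfl
  rw [this, Nat.card_prod, Nat.card_zmod, sq]

theorem HasAbelianizationTypePP.pow_mem_commutator (h : HasAbelianizationTypePP p G) (g : G) :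
    g ^ p ∈ commutator G := by
  obtain ⟨f, hf, hk⟩ := h.exists_hom
  rw [← hk, MonoidHom.mem_ker, map_pow]
  apply Multiplicative.toAdd.injective
  ext <;> simp

theorem HasAbelianizationTypePP.exists_closure_pair_eq_top [Fact p.Prime] [Finite G]
    (hp : IsPGroup p G) (h : HasAbelianizationTypePP p G) :
    ∃ x y : G, closure {x, y} = ⊤ := by
  obtain ⟨f, hf, hk⟩ := h.exists_hom
  obtain ⟨x, hx⟩ := hf (Multiplicative.ofAdd (1, 0))
  obtain ⟨y, hy⟩ := hf (Multiplicative.ofAdd (0, 1))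
  refine ⟨x, y, ?_⟩
  obtain h | ⟨M, hM, hle⟩ := eq_top_or_exists_le_coatom (closure {x, y})
  · exact h
  refine absurd ?_ hM.1
  have hxM : x ∈ M := hle (subset_closure (by simp))
  have hyM : y ∈ M := hle (subset_closure (by simp))
  have hc : f.ker ≤ M := hk ▸ commutator_le_of_isCoatom hp hM
  rw [eq_top_iff]
  intro g _
  have h1 : x ^ (f g).toAdd.1.val * y ^ (f g).toAdd.2.val ∈ M :=
    M.mul_mem (M.pow_mem hxM _) (M.pow_mem hyM _)
  have h2 : (x ^ (f g).toAdd.1.val * y ^ (f g).toAdd.2.val)⁻¹ * g ∈ f.ker := by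
    rw [MonoidHom.mem_ker, map_mul, map_inv, inv_mul_eq_one, map_mul, map_pow, map_pow, hx, hy]
    apply Multiplicative.toAdd.injective
    ext <;> simp
  have h3 := M.mul_mem h1 (hc h2)
  rwa [mul_inv_cancel_left] at h3

/-- In a plane the hyperplanes are the lines, that is, the points of a projective line over k. -/
theorem ncard_isCoatom_submodule {k V : Type*} [Field k] [Finite k] [AddCommGroup V] [Module k V]
    (h : Module.finrank k V = 2) :
    {W : Submodule k V | IsCoatom W}.ncard = Nat.card k + 1 := by
  have : FiniteDimensional k V := Module.finite_of_finrank_eq_succ h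
  rw [← Projectivization.card_of_finrank_two k V h,
    Nat.card_congr (Projectivization.equivSubmodule k V), ← Nat.card_coe_set_eq]
  refine Nat.card_congr (Equiv.subtypeEquivRight fun W => ?_)
  change IsCoatom W ↔ _
  rw [← isSimpleModule_iff_isCoatom, isSimpleModule_iff_finrank_eq_one]
  have := W.finrank_quotient_add_finrank
  omega

theorem ncard_isCoatom_multiplicative [Fact p.Prime] :
    {M : Subgroup (Multiplicative (ZMod p × ZMod p)) | IsCoatom M}.ncard = p + 1 := by
  have h := ncard_isCoatom_submodule (k := ZMod p) (V := ZMod p × ZMod p) (by simp)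
  rw [Nat.card_zmod, ← Nat.card_coe_set_eq] at h
  let e := (AddSubgroup.toSubgroup (A := ZMod p × ZMod p)).symm.trans
    (AddSubgroup.toZModSubmodule p)
  rw [← h, ← Nat.card_coe_set_eq]
  exact Nat.card_congr (e.toEquiv.subtypeEquiv fun M => (e.isCoatom_iff M).symm)

theorem HasAbelianizationTypePP.ncard_isCoatom [Fact p.Prime] [Finite G]
    (hp : IsPGroup p G) (h : HasAbelianizationTypePP p G) :
    {M : Subgroup G | IsCoatom M}.ncard = p + 1 := by
  obtain ⟨f, hf, hk⟩ := h.exists_hom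
  rw [← ncard_isCoatom_multiplicative (p := p), eq_comm]
  refine Set.ncard_congr (fun M _ => M.comap f) ?_ ?_ ?_
  · exact fun M hM => isCoatom_comap_of_surjective hf hM
  · exact fun M N _ _ hMN => comap_injective hf hMN
  · intro M hM
    have hc : f.ker ≤ M := hk ▸ commutator_le_of_isCoatom hp hM
    have hcm : (M.map f).comap f = M := comap_map_eq_self hc
    refine ⟨M.map f, ⟨?_, ?_⟩, hcm⟩
    · intro ht
      rw [ht, comap_top] at hcm
      exact hM.1 hcm.symm
    · intro K hK
      have h1 : M < K.comap f := by
        rw [← hcm]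
        exact (comap_lt_comap_of_surjective hf).2 hK
      have h2 := hM.2 _ h1
      rw [← comap_top f] at h2
      exact comap_injective hf h2

/-- The kernels of the two coordinate maps to ℤ/p are maximal and already intersect in G'. -/
theorem HasAbelianizationTypePP.frattini_eq [Fact p.Prime] [Finite G]
    (hp : IsPGroup p G) (h : HasAbelianizationTypePP p G) : frattini G = commutator G := by
  apply le_antisymm
  · obtain ⟨f, hf, hk⟩ := h.exists_hom
    have key : ∀ q : Multiplicative (ZMod p × ZMod p) →* Multiplicative (ZMod p),
        Function.Surjective q → frattini G ≤ (q.comp f).ker := by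
      intro q hq
      refine frattini_le_coatom ?_
      have hs : Function.Surjective (q.comp f) := hq.comp hf
      have := isCoatom_comap_of_surjective hs (M := (⊥ : Subgroup (Multiplicative (ZMod p)))) ?_
      · exact this
      · have : IsSimpleGroup (Multiplicative (ZMod p)) :=
          isSimpleGroup_of_prime_card (p := p) (Nat.card_zmod p)
        exact isCoatom_bot
    intro g hg
    have h1 := key (AddMonoidHom.toMultiplicative (AddMonoidHom.fst (ZMod p) (ZMod p)))
      (fun a => ⟨Multiplicative.ofAdd (a.toAdd, 0), rfl⟩) hg
    have h2 := key (AddMonoidHom.toMultiplicative (AddMonoidHom.snd (ZMod p) (ZMod p)))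
      (fun a => ⟨Multiplicative.ofAdd (0, a.toAdd), rfl⟩) hg
    rw [← hk, MonoidHom.mem_ker]
    apply Multiplicative.toAdd.injective
    exact Prod.ext (congrArg Multiplicative.toAdd h1) (congrArg Multiplicative.toAdd h2)
  · unfold frattini
    rw [Order.radical]
    exact le_iInf₂ fun M hM => commutator_le_of_isCoatom hp hM

end TypePP

/-! ### Naturality of the Artin transfer and comparison of targets. -/

section Transfer

variable {G : Type u} [Group G] {H : Type v} [Group H]

theorem transfer_eq_prod_of_section {A : Type*} [CommGroup A] {U : Subgroup G} [U.FiniteIndex]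
    [Fintype (G ⧸ U)] (ϕ : U →* A) {σ : G ⧸ U → G} (hσ : ∀ q, (σ q : G ⧸ U) = q) (g : G) :
    MonoidHom.transfer ϕ g = ∏ q : G ⧸ U, ϕ ⟨(σ q)⁻¹ * (g * σ (g⁻¹ • q)), by
      rw [← QuotientGroup.eq, hσ]
      change q = g • (σ (g⁻¹ • q) : G ⧸ U)
      rw [hσ, smul_inv_smul]⟩ := by
  rw [MonoidHom.transfer_def ϕ ⟨Set.range σ, isComplement_range_left hσ⟩, leftTransversals.diff]
  refine Finset.prod_congr (by congr!) fun q _ => ?_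
  congr 2
  rw [smul_apply_eq_smul_apply_inv_smul, IsComplement.leftQuotientEquiv_apply hσ,
    IsComplement.leftQuotientEquiv_apply hσ]
  rfl

theorem inducedTargetMap_of (φ : G →* H) (U : Subgroup G) (u : U) :
    inducedTargetMap φ U (Abelianization.of u) =
      Abelianization.of (⟨φ u, mem_map_of_mem φ u.2⟩ : U.map φ) := rfl

theorem artinTransfer_map {φ : G →* H} (hφ : Function.Surjective φ) {U : Subgroup G}
    (hU : φ.ker ≤ U) [U.FiniteIndex] [(U.map φ).FiniteIndex] (g : G) :
    artinTransfer (U.map φ) (φ g) = inducedTargetMap φ U (artinTransfer U g) := by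
  classical
  let _ := U.fintypeQuotientOfFiniteIndex
  let _ := (U.map φ).fintypeQuotientOfFiniteIndex
  have hmem : ∀ a b : G, (φ a)⁻¹ * φ b ∈ U.map φ ↔ a⁻¹ * b ∈ U := by
    intro a b
    rw [← map_inv, ← map_mul, ← mem_comap, comap_map_eq_self hU]
  let e₀ : G ⧸ U → H ⧸ U.map φ :=
    Quotient.map' φ fun a b hab => by
      rw [QuotientGroup.leftRel_apply] at hab ⊢
      exact (hmem a b).2 hab
  have he₀ : Function.Bijective e₀ := by
    constructor
    · intro a b
      induction a using QuotientGroup.induction_on with | H a => ?_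
      induction b using QuotientGroup.induction_on with | H b => ?_
      intro hab
      exact QuotientGroup.eq.2 ((hmem a b).1 (QuotientGroup.eq.1 hab))
    · intro b
      induction b using QuotientGroup.induction_on with | H b => ?_
      obtain ⟨a, rfl⟩ := hφ b
      exact ⟨a, rfl⟩
  let e := Equiv.ofBijective e₀ he₀
  have he : ∀ a : G, e (a : G ⧸ U) = (φ a : H ⧸ U.map φ) := fun _ => rfl
  have hes : ∀ q : G ⧸ U, e (g⁻¹ • q) = (φ g)⁻¹ • e q := by
    intro q
    induction q using QuotientGroup.induction_on with | H a => ?_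
    change ((φ (g⁻¹ * a) : H) : H ⧸ U.map φ) = (((φ g)⁻¹ * φ a : H) : H ⧸ U.map φ)
    rw [map_mul, map_inv]
  -- Representatives in H are images of those chosen in G, so the two transfer products agree factor
  -- by factor.
  have hτ : ∀ q : H ⧸ U.map φ, ((φ (e.symm q).out : H) : H ⧸ U.map φ) = q := by
    intro q
    rw [← he, QuotientGroup.out_eq', e.apply_symm_apply]
  rw [artinTransfer, artinTransfer,
    transfer_eq_prod_of_section _ (fun q : G ⧸ U => QuotientGroup.out_eq' q),
    transfer_eq_prod_of_section _ hτ, map_prod]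
  refine (Fintype.prod_equiv e _ _ fun q => ?_).symm
  rw [inducedTargetMap_of]
  congr 2
  simp only [← hes, e.symm_apply_apply, map_mul, map_inv]

theorem kernelPrecedes_of_ker_le {φ : G →* H} (hφ : Function.Surjective φ) {U : Subgroup G}
    (hU : φ.ker ≤ U) [U.FiniteIndex] [(U.map φ).FiniteIndex] : KernelPrecedes φ U := by
  rintro _ ⟨g, hg, rfl⟩
  have hg' : artinTransfer U g = 1 := hg
  change artinTransfer (U.map φ) (φ g) = 1
  rw [artinTransfer_map hφ hU, hg', map_one]

theorem inducedTargetMap_surjective (φ : G →* H) (U : Subgroup G) :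
    Function.Surjective (inducedTargetMap φ U) := by
  intro b
  obtain ⟨⟨_, u, hu, rfl⟩, rfl⟩ := QuotientGroup.mk'_surjective _ b
  exact ⟨Abelianization.of ⟨u, hu⟩, rfl⟩

theorem targetPrecedes (φ : G →* H) (U : Subgroup G) : TargetPrecedes φ U :=
  ⟨(QuotientGroup.quotientKerEquivOfSurjective _ (inducedTargetMap_surjective φ U)).symm⟩

theorem targetStrictlyPrecedes_of_not_ker_le [Finite G] {φ : G →* H} {U : Subgroup G}
    (hU : φ.ker ≤ U) (h : ¬ φ.ker ≤ ⁅U, U⁆) : TargetStrictlyPrecedes φ U := by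
  refine ⟨targetPrecedes φ U, ?_⟩
  rintro ⟨e⟩
  refine h fun g hg => ?_
  have hfin : Finite (TransferTarget U) := inferInstanceAs (Finite (_ ⧸ _))
  have hinj : Function.Injective (inducedTargetMap φ U) := by
    -- An isomorphism of targets would make this a surjective self-map of a finite set.
    have := Finite.injective_iff_surjective (f := e ∘ inducedTargetMap φ U)
    exact (this.2 (e.surjective.comp (inducedTargetMap_surjective φ U))).of_comp
  have h1 : inducedTargetMap φ U (Abelianization.of ⟨g, hU hg⟩) = 1 := by
    rw [inducedTargetMap_of]
    have : (⟨φ g, mem_map_of_mem φ (hU hg)⟩ : U.map φ) = 1 := Subtype.ext hg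
    exact (congrArg _ this).trans (map_one _)
  have h2 : (⟨g, hU hg⟩ : U) ∈ commutator U := by
    rw [← Abelianization.ker_of, MonoidHom.mem_ker]
    exact hinj (h1.trans (map_one _).symm)
  have h3 := mem_map_of_mem U.subtype h2
  rwa [map_subtype_commutator] at h3

end Transfer

/-! ### Order bounds for γ₂, γ₃ and U' in a two-generator group. -/

section TwoGenerator

variable {G : Type u} [Group G]

theorem normal_of_le_center {N : Subgroup G} (h : N ≤ center G) : N.Normal :=
  ⟨fun n hn g => by rwa [mem_center_iff.1 (h hn) g, mul_inv_cancel_right]⟩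

theorem closure_pair_commutator_le {x y : G} {N : Subgroup G} [N.Normal]
    (hxy : Subgroup.closure {x, y} = ⊤) (h : ⁅x, y⁆ ∈ N) : commutator G ≤ N := by
  rw [commutator_def, ← hxy]
  refine commutator_closure_closure_le ?_
  rintro a (rfl | rfl) b (rfl | rfl)
  · simp
  · exact h
  · rw [← commutatorElement_inv]; exact N.inv_mem h
  · simp

theorem commutator_eq_zpowers_sup {x y : G} (hxy : Subgroup.closure {x, y} = ⊤) :
    commutator G = zpowers ⁅x, y⁆ ⊔ ⁅commutator G, (⊤ : Subgroup G)⁆ := by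
  have hs : ⁅x, y⁆ ∈ commutator G := commutator_mem_commutator (mem_top x) (mem_top y)
  have hle : zpowers ⁅x, y⁆ ⊔ ⁅commutator G, (⊤ : Subgroup G)⁆ ≤ commutator G :=
    sup_le (by rwa [zpowers_le]) (commutator_le_left _ _)
  have hN : (zpowers ⁅x, y⁆ ⊔ ⁅commutator G, (⊤ : Subgroup G)⁆).Normal := by
    refine ⟨fun n hn g => ?_⟩
    have h1 : ⁅g, n⁆ ∈ ⁅commutator G, (⊤ : Subgroup G)⁆ := by
      rw [commutator_comm]
      exact commutator_mem_commutator (mem_top g) (hle hn)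
    have h2 : g * n * g⁻¹ = ⁅g, n⁆ * n := by simp [commutatorElement_def]
    rw [h2]
    exact mul_mem (le_sup_right (a := zpowers ⁅x, y⁆) h1) hn
  exact le_antisymm (closure_pair_commutator_le hxy
    (mem_sup_left (mem_zpowers _))) hle

theorem commutator_eq_closure_insert {x y : G} (hxy : Subgroup.closure {x, y} = ⊤) :
    commutator G =
      Subgroup.closure (insert ⁅x, y⁆ ((⁅commutator G, (⊤ : Subgroup G)⁆ : Subgroup G) : Set G)) := by
  rw [Set.insert_eq, Subgroup.closure_union, ← zpowers_eq_closure, closure_eq]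
  exact commutator_eq_zpowers_sup hxy

/-- Modulo the central subgroup ⟨[s, b]⟩, b commutes with s and with γ₃, hence with all of G' = ⟨s,
γ₃⟩. -/
theorem commutatorElement_mem_of_mem_commutator {x y g b : G} (hxy : Subgroup.closure {x, y} = ⊤)
    (hc : ⁅commutator G, (⊤ : Subgroup G)⁆ ≤ center G) (hg : g ∈ commutator G) :
    ⁅g, b⁆ ∈ zpowers ⁅⁅x, y⁆, b⁆ := by
  have hs : ⁅x, y⁆ ∈ commutator G := commutator_mem_commutator (mem_top x) (mem_top y)
  have hz : zpowers ⁅⁅x, y⁆, b⁆ ≤ center G := by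
    rw [zpowers_le]
    exact hc (commutator_mem_commutator hs (mem_top b))
  have := normal_of_le_center hz
  have h : ⁅Subgroup.closure (insert ⁅x, y⁆ ((⁅commutator G, (⊤ : Subgroup G)⁆ : Subgroup G) : Set G)), Subgroup.closure {b}⁆ ≤
      zpowers ⁅⁅x, y⁆, b⁆ := by
    refine commutator_closure_closure_le ?_
    rintro a (rfl | ha) b rfl
    · exact mem_zpowers _
    · have : ⁅a, b⁆ = 1 := commutatorElement_eq_one_iff_mul_comm.2
        (mem_center_iff.1 (hc ha) b).symm
      rw [this]
      exact one_mem _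
  rw [← commutator_eq_closure_insert hxy] at h
  exact h (commutator_mem_commutator hg (subset_closure rfl))

theorem commutator_commutator_top_le {x y : G} {N : Subgroup G} (hxy : Subgroup.closure {x, y} = ⊤)
    (hc : ⁅commutator G, (⊤ : Subgroup G)⁆ ≤ center G) (hN : N ≤ center G)
    (hx : ⁅⁅x, y⁆, x⁆ ∈ N) (hy : ⁅⁅x, y⁆, y⁆ ∈ N) : ⁅commutator G, (⊤ : Subgroup G)⁆ ≤ N := by
  have := normal_of_le_center hN
  have h : ⁅Subgroup.closure (insert ⁅x, y⁆ ((⁅commutator G, (⊤ : Subgroup G)⁆ : Subgroup G) : Set G)),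
      Subgroup.closure {x, y}⁆ ≤ N := by
    refine commutator_closure_closure_le ?_
    rintro a (rfl | ha) b hb
    · obtain rfl | rfl := hb
      exacts [hx, hy]
    · have : ⁅a, b⁆ = 1 := commutatorElement_eq_one_iff_mul_comm.2
        (mem_center_iff.1 (hc ha) b).symm
      rw [this]
      exact one_mem _
  rwa [← commutator_eq_closure_insert hxy, hxy] at h

theorem commutatorElement_pow_eq_one {p : ℕ} {s x : G}
    (hpow : ∀ g : G, g ^ p ∈ commutator G) (hmet : ⁅commutator G, commutator G⁆ = ⊥)
    (hc : ⁅commutator G, (⊤ : Subgroup G)⁆ ≤ center G) (hs : s ∈ commutator G) :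
    ⁅s, x⁆ ^ p = 1 := by
  have h1 : ⁅s, x⁆ ∈ center G := hc (commutator_mem_commutator hs (mem_top x))
  rw [← commutatorElement_pow_right (mem_center_iff.1 h1 x).symm, ← mem_bot, ← hmet]
  exact commutator_mem_commutator hs (hpow x)

theorem card_zpowers_le_of_pow_eq_one {n : ℕ} (hn : 0 < n) {u : G} (h : u ^ n = 1) :
    Nat.card (zpowers u) ≤ n := by
  rw [Nat.card_zpowers]
  exact orderOf_le_of_pow_eq_one hn h

/-- Modulo γ₃ the element s is central, so s^p ≡ [x, y^p] ≡ 1 because y^p lies in G'. -/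
theorem card_commutator_le [Finite G] {p : ℕ} (hp : 0 < p) {x y : G} (hxy : Subgroup.closure {x, y} = ⊤)
    (hpow : ∀ g : G, g ^ p ∈ commutator G) :
    Nat.card (commutator G) ≤ p * Nat.card (⁅commutator G, (⊤ : Subgroup G)⁆ : Subgroup G) := by
  have hs : ⁅x, y⁆ ∈ commutator G := commutator_mem_commutator (mem_top x) (mem_top y)
  set L := ⁅commutator G, (⊤ : Subgroup G)⁆ with hL
  have key : ⁅x, y⁆ ^ p ∈ L := by
    have hcomm : Commute ⁅(x : G ⧸ L), (y : G ⧸ L)⁆ (y : G ⧸ L) := by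
      rw [← commutatorElement_eq_one_iff_commute]
      have : ⁅⁅x, y⁆, y⁆ ∈ L := commutator_mem_commutator hs (mem_top y)
      exact (QuotientGroup.eq_one_iff _).2 this
    have h1 := commutatorElement_pow_right hcomm p
    have h2 : ⁅x, y ^ p⁆ ∈ L := by
      rw [hL, commutator_comm]
      exact commutator_mem_commutator (mem_top x) (hpow y)
    have h3 : ⁅(x : G ⧸ L), (y : G ⧸ L) ^ p⁆ = 1 := (QuotientGroup.eq_one_iff _).2 h2
    rw [h3] at h1
    exact (QuotientGroup.eq_one_iff _).1 h1.symm
  have h := card_zpowers_sup_le hp key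
  rwa [hL, ← commutator_eq_zpowers_sup hxy] at h

theorem card_commutator_commutator_top_le [Finite G] {p : ℕ} (hp : 0 < p) {x y : G}
    (hxy : Subgroup.closure {x, y} = ⊤)
    (hpow : ∀ g : G, g ^ p ∈ commutator G) (hmet : ⁅commutator G, commutator G⁆ = ⊥)
    (hc : ⁅commutator G, (⊤ : Subgroup G)⁆ ≤ center G) :
    Nat.card (⁅commutator G, (⊤ : Subgroup G)⁆ : Subgroup G) ≤ p ^ 2 := by
  have hs : ⁅x, y⁆ ∈ commutator G := commutator_mem_commutator (mem_top x) (mem_top y)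
  have hz : ∀ b : G, zpowers ⁅⁅x, y⁆, b⁆ ≤ center G := fun b => by
    rw [zpowers_le]
    exact hc (commutator_mem_commutator hs (mem_top b))
  have hpw : ∀ b : G, ⁅⁅x, y⁆, b⁆ ^ p = 1 := fun b => commutatorElement_pow_eq_one hpow hmet hc hs
  have := normal_of_le_center (hz y)
  have hle := commutator_commutator_top_le (N := zpowers ⁅⁅x, y⁆, x⁆ ⊔ zpowers ⁅⁅x, y⁆, y⁆) hxy hc
    (sup_le (hz x) (hz y)) (le_sup_left (b := zpowers ⁅⁅x, y⁆, y⁆) (mem_zpowers _))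
    (le_sup_right (a := zpowers ⁅⁅x, y⁆, x⁆) (mem_zpowers _))
  calc _ ≤ _ := card_le_of_le hle
    _ ≤ p * Nat.card (zpowers ⁅⁅x, y⁆, y⁆) :=
      card_zpowers_sup_le hp (by rw [hpw]; exact one_mem _)
    _ ≤ p ^ 2 := by rw [sq]; exact Nat.mul_le_mul_left _ (card_zpowers_le_of_pow_eq_one hp (hpw y))

theorem card_commutator_isCoatom_le [Finite G] {p : ℕ} [Fact p.Prime] (hpG : IsPGroup p G)
    {x y : G} (hxy : Subgroup.closure {x, y} = ⊤)
    (hpow : ∀ g : G, g ^ p ∈ commutator G) (hidx : (commutator G).index = p ^ 2)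
    (hmet : ⁅commutator G, commutator G⁆ = ⊥)
    (hc : ⁅commutator G, (⊤ : Subgroup G)⁆ ≤ center G) {U : Subgroup G} (hU : IsCoatom U) :
    Nat.card (⁅U, U⁆ : Subgroup G) ≤ p := by
  have hp : p.Prime := Fact.out
  have hs : ⁅x, y⁆ ∈ commutator G := commutator_mem_commutator (mem_top x) (mem_top y)
  have hle := commutator_le_of_isCoatom hpG hU
  have hrel : (commutator G).relIndex U = p := by
    have h := relIndex_mul_index hle
    rw [index_eq_of_isCoatom hpG hU, hidx, sq] at h
    exact Nat.eq_of_mul_eq_mul_right hp.pos h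
  -- As |U : G'| = p is prime, any such t generates U together with G'.
  obtain ⟨t, htU, ht⟩ : ∃ t ∈ U, t ∉ commutator G := by
    by_contra! h
    rw [relIndex_eq_one.2 h] at hrel
    exact hp.one_lt.ne hrel
  have hUt : U = zpowers t ⊔ commutator G := by
    have h1 : zpowers t ⊔ commutator G ≤ U := sup_le (by rwa [zpowers_le]) hle
    have h2 := relIndex_mul_relIndex _ _ _ (le_sup_right (a := zpowers t) (b := commutator G)) h1
    rw [hrel] at h2
    obtain h3 | h3 := (Nat.dvd_prime hp).1 (Dvd.intro _ h2)
    · exact absurd (relIndex_eq_one.1 h3 (le_sup_left (b := commutator G) (mem_zpowers t))) ht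
    · rw [h3] at h2
      exact le_antisymm (relIndex_eq_one.1 (Nat.eq_of_mul_eq_mul_left hp.pos (by simpa using h2))) h1
  have hcl : U = Subgroup.closure (insert t (commutator G : Set G)) := by
    rw [Set.insert_eq, Subgroup.closure_union, ← zpowers_eq_closure, closure_eq, hUt]
  have hz : zpowers ⁅⁅x, y⁆, t⁆ ≤ center G := by
    rw [zpowers_le]
    exact hc (commutator_mem_commutator hs (mem_top t))
  have := normal_of_le_center hz
  have hUU : ⁅U, U⁆ ≤ zpowers ⁅⁅x, y⁆, t⁆ := by
    rw [hcl]
    refine commutator_closure_closure_le ?_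
    rintro a (rfl | ha) b (rfl | hb)
    · simp
    · rw [← commutatorElement_inv b]
      exact inv_mem (commutatorElement_mem_of_mem_commutator hxy hc hb)
    · exact commutatorElement_mem_of_mem_commutator hxy hc ha
    · have : ⁅a, b⁆ ∈ ⁅commutator G, commutator G⁆ := commutator_mem_commutator ha hb
      rw [hmet, mem_bot] at this
      rw [this]
      exact one_mem _
  exact (card_le_of_le hUU).trans
    (card_zpowers_le_of_pow_eq_one hp.pos (commutatorElement_pow_eq_one hpow hmet hc hs))

theorem mem_pair_of_mem_zpowers_of_sq {a b : G} (hb : b ^ 2 = 1) (h : a ∈ zpowers b) :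
    a = 1 ∨ a = b := by
  obtain ⟨k, rfl⟩ := mem_zpowers_iff.1 h
  have hb' : b ^ (2 : ℤ) = 1 := by exact_mod_cast hb
  obtain ⟨m, rfl | rfl⟩ := Int.even_or_odd' k
  · left; rw [zpow_mul, hb', one_zpow]
  · right; rw [zpow_add, zpow_mul, hb', one_zpow, one_mul, zpow_one]

/-- With u = [s, x] and v = [s, y], the squares x², y² in G' give u⁻¹s² ∈ ⟨v⟩ and s²v ∈ ⟨u⟩. As |γ₃|
> 2 makes u, v distinct and nontrivial, only s² = uv survives. -/
theorem sq_commutatorElement_eq [Finite G] {x y : G} (hxy : Subgroup.closure {x, y} = ⊤)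
    (hpow : ∀ g : G, g ^ 2 ∈ commutator G) (hmet : ⁅commutator G, commutator G⁆ = ⊥)
    (hc : ⁅commutator G, (⊤ : Subgroup G)⁆ ≤ center G)
    (hcard : 2 < Nat.card (⁅commutator G, (⊤ : Subgroup G)⁆ : Subgroup G)) :
    ⁅⁅x, y⁆, x⁆ ≠ 1 ∧ ⁅⁅x, y⁆, y⁆ ≠ 1 ∧ ⁅x, y⁆ ^ 2 = ⁅⁅x, y⁆, x⁆ * ⁅⁅x, y⁆, y⁆ := by
  have hs : ⁅x, y⁆ ∈ commutator G := commutator_mem_commutator (mem_top x) (mem_top y)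
  have hpw : ∀ b : G, ⁅⁅x, y⁆, b⁆ ^ 2 = 1 := fun b => commutatorElement_pow_eq_one hpow hmet hc hs
  have hcen : ∀ b : G, ⁅⁅x, y⁆, b⁆ ∈ center G := fun b =>
    hc (commutator_mem_commutator hs (mem_top b))
  have hnot : ∀ b : G, ¬ (⁅⁅x, y⁆, x⁆ ∈ zpowers ⁅⁅x, y⁆, b⁆ ∧ ⁅⁅x, y⁆, y⁆ ∈ zpowers ⁅⁅x, y⁆, b⁆) := by
    rintro b ⟨h1, h2⟩
    have hle := commutator_commutator_top_le hxy hc (by rw [zpowers_le]; exact hcen b) h1 h2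
    have := (card_le_of_le hle).trans (card_zpowers_le_of_pow_eq_one two_pos (hpw b))
    omega
  have h1 : ⁅x ^ 2, y⁆ = ⁅⁅x, y⁆, x⁆⁻¹ * ⁅x, y⁆ ^ 2 := by
    simp [commutatorElement_def, sq, mul_assoc]
  have h2 : ⁅x, y ^ 2⁆ = ⁅x, y⁆ ^ 2 * ⁅⁅x, y⁆⁻¹, y⁆ := by
    simp [commutatorElement_def, sq, mul_assoc]
  have m1 : ⁅x ^ 2, y⁆ ∈ zpowers ⁅⁅x, y⁆, y⁆ :=
    commutatorElement_mem_of_mem_commutator hxy hc (hpow x)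
  have m2 : ⁅x, y ^ 2⁆ ∈ zpowers ⁅⁅x, y⁆, x⁆ := by
    rw [← commutatorElement_inv (y ^ 2)]
    exact inv_mem (commutatorElement_mem_of_mem_commutator hxy hc (hpow y))
  have h3 : ⁅⁅x, y⁆⁻¹, y⁆ = ⁅⁅x, y⁆, y⁆ := by
    have h := commutatorElement_pow_eq_one (x := y) hpow hmet hc hs
    have h' : ⁅⁅x, y⁆⁻¹, y⁆ = ⁅x, y⁆⁻¹ * ⁅⁅x, y⁆, y⁆⁻¹ * ⁅x, y⁆ := by
      simp only [commutatorElement_def]; group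
    rw [h', mem_center_iff.1 (inv_mem (hcen y)), inv_mul_cancel_right, inv_eq_iff_mul_eq_one,
      ← sq, h]
  rw [h1] at m1
  rw [h2, h3] at m2
  have hnx := hnot x
  have hny := hnot y
  have hxx := hpw x
  have hyy := hpw y
  have hcomm := mem_center_iff.1 (hcen x) ⁅⁅x, y⁆, y⁆
  generalize ⁅⁅x, y⁆, x⁆ = u at *
  generalize ⁅⁅x, y⁆, y⁆ = v at *
  generalize ⁅x, y⁆ ^ 2 = z at *
  have hv1 : v ≠ 1 := by rintro rfl; exact hnx ⟨mem_zpowers _, one_mem _⟩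
  have hu1 : u ≠ 1 := by rintro rfl; exact hny ⟨one_mem _, mem_zpowers _⟩
  have huv : u ≠ v := by rintro rfl; exact hny ⟨mem_zpowers _, mem_zpowers _⟩
  refine ⟨hu1, hv1, ?_⟩
  have hvv : v⁻¹ = v := inv_eq_of_mul_eq_one_left (by rw [← sq, hyy])
  obtain h | h := mem_pair_of_mem_zpowers_of_sq hyy m1
  · obtain rfl : z = u := (inv_mul_eq_one.1 h).symm
    obtain h' | h' := mem_pair_of_mem_zpowers_of_sq hxx m2
    · rw [mul_eq_one_iff_eq_inv, hvv] at h'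
      exact absurd h' huv
    · exact absurd (mul_eq_left.1 h') hv1
  · exact inv_mul_eq_iff_eq_mul.1 h

/-- If |γ₃| > 2, the formula for s² holds for every generating pair. Replacing x by xy keeps s but
multiplies the right-hand side by [s, y] ≠ 1. -/
theorem card_commutator_commutator_top_le_two [Finite G] {x y : G} (hxy : Subgroup.closure {x, y} = ⊤)
    (hpow : ∀ g : G, g ^ 2 ∈ commutator G) (hmet : ⁅commutator G, commutator G⁆ = ⊥)
    (hc : ⁅commutator G, (⊤ : Subgroup G)⁆ ≤ center G) :
    Nat.card (⁅commutator G, (⊤ : Subgroup G)⁆ : Subgroup G) ≤ 2 := by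
  by_contra! hcard
  have hxy' : Subgroup.closure {x * y, y} = ⊤ := by
    rw [eq_top_iff, ← hxy, closure_le]
    have hy : y ∈ Subgroup.closure {x * y, y} := subset_closure (by simp)
    rintro a (rfl | rfl)
    · have h : a * y ∈ closure {a * y, y} := subset_closure (by simp)
      simpa using mul_mem h (inv_mem hy)
    · exact hy
  obtain ⟨hu, hv, h⟩ := sq_commutatorElement_eq hxy hpow hmet hc hcard
  obtain ⟨-, -, h'⟩ := sq_commutatorElement_eq hxy' hpow hmet hc hcard
  have hs : ⁅x, y⁆ ∈ commutator G := commutator_mem_commutator (mem_top x) (mem_top y)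
  have e1 : ⁅x * y, y⁆ = ⁅x, y⁆ := by simp only [commutatorElement_def]; group
  have hcen := mem_center_iff.1 (hc (commutator_mem_commutator hs (mem_top y)))
  have e2 : ⁅⁅x, y⁆, x * y⁆ = ⁅⁅x, y⁆, x⁆ * ⁅⁅x, y⁆, y⁆ := by
    have : ⁅⁅x, y⁆, x * y⁆ = ⁅⁅x, y⁆, x⁆ * (x * ⁅⁅x, y⁆, y⁆ * x⁻¹) := by
      simp only [commutatorElement_def]; group
    rw [this, hcen x, mul_inv_cancel_right]
  rw [e1, e2, h] at h'
  exact hv (mul_eq_left.1 h'.symm)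

end TwoGenerator

/-! ### The last lower central term in classes 2 and 3. -/

section LowerCentralSeries

variable {G : Type u} [Group G]

theorem lastLowerCentral_eq_of_class_two (h : Group.nilpotencyClass G = 2) :
    lastLowerCentral G = commutator G := by
  rw [lastLowerCentral, h]; rfl

theorem lastLowerCentral_eq_of_class_three (h : Group.nilpotencyClass G = 3) :
    lastLowerCentral G = ⁅commutator G, (⊤ : Subgroup G)⁆ := by
  rw [lastLowerCentral, h]; rfl

theorem lowerCentralSeries_le_center [Group.IsNilpotent G] {n : ℕ}
    (h : Group.nilpotencyClass G = n + 1) :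
    (⊤ : Subgroup G).lowerCentralSeries n ≤ center G := by
  have h1 : (⊤ : Subgroup G).lowerCentralSeries (n + 1) = ⊥ := by
    rw [← h, Subgroup.lowerCentralSeries_nilpotencyClass]
  rw [Subgroup.lowerCentralSeries_succ, commutator_eq_bot_iff_le_centralizer] at h1
  rwa [coe_top, centralizer_univ] at h1

end LowerCentralSeries

/-! ### The two cases: class 3 with coclass at least 2, class 2 with coclass 1. -/

section ClassTwoAndThree

variable {p : ℕ} [Fact p.Prime] {G : Type u} [Group G] [Finite G]

theorem HasAbelianizationTypePP.card_eq_pow (hp : IsPGroup p G)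
    (hab : HasAbelianizationTypePP p G) {c : ℕ}
    {d : ℤ} (hc : Group.nilpotencyClass G = c) (hd : coclass p G = d) :
    ∃ n : ℕ, Nat.card G = p ^ n ∧ (n : ℤ) = c + d ∧ p ^ 2 * Nat.card (commutator G) = p ^ n := by
  obtain ⟨n, hn⟩ := IsPGroup.iff_card.1 hp
  refine ⟨n, hn, ?_, ?_⟩
  · rw [coclass, hn, padicValNat.prime_pow, hc] at hd
    omega
  · rw [← hn, ← (commutator G).index_mul_card, hab.index_commutator]

theorem class_three_structure (hp : IsPGroup p G) (hmet : IsMetabelian G)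
    (hab : HasAbelianizationTypePP p G) (hcc : 2 ≤ coclass p G)
    (hcl : Group.nilpotencyClass G = 3) :
    3 ≤ p ∧ coclass p G = 2 ∧ p ^ 2 ≤ Nat.card (lastLowerCentral G) ∧
      ∀ U : Subgroup G, IsCoatom U → Nat.card (⁅U, U⁆ : Subgroup G) ≤ p := by
  have hpp : p.Prime := Fact.out
  have := hp.isNilpotent
  obtain ⟨x, y, hxy⟩ := hab.exists_closure_pair_eq_top hp
  have hpow := hab.pow_mem_commutator
  have hmet' : ⁅commutator G, commutator G⁆ = ⊥ := hmet
  have hc : ⁅commutator G, (⊤ : Subgroup G)⁆ ≤ center G := lowerCentralSeries_le_center hcl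
  obtain ⟨n, -, hn, hcard⟩ := hab.card_eq_pow hp hcl rfl
  have h1 := card_commutator_le hpp.pos hxy hpow
  have h2 := card_commutator_commutator_top_le hpp.pos hxy hpow hmet' hc
  rw [lastLowerCentral_eq_of_class_three hcl]
  set l := Nat.card (⁅commutator G, (⊤ : Subgroup G)⁆ : Subgroup G)
  have h3 : p ^ n ≤ p ^ 3 * l := by
    rw [← hcard, pow_succ p 2, mul_assoc]
    exact Nat.mul_le_mul_left _ h1
  -- Here n = 3 + cc(G) ≥ 5.
  have h4 : p ^ 5 ≤ p ^ n := Nat.pow_le_pow_right hpp.pos (by push_cast at hn; omega)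
  have h5 : p ^ n ≤ p ^ 5 := h3.trans (by
    rw [pow_add p 3 2]; exact Nat.mul_le_mul_left _ h2)
  have h6 : n = 5 := Nat.pow_right_injective hpp.two_le (le_antisymm h5 h4)
  have h7 : p ^ 2 ≤ l := by
    refine Nat.le_of_mul_le_mul_left ?_ (pow_pos hpp.pos 3)
    rw [← pow_add]
    exact h4.trans h3
  refine ⟨?_, by push_cast at hn; omega, h7, fun U hU =>
    card_commutator_isCoatom_le hp hxy hpow hab.index_commutator hmet' hc hU⟩
  refine lt_of_le_of_ne hpp.two_le ?_
  rintro rfl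
  have h8 : l ≤ 2 := card_commutator_commutator_top_le_two hxy hpow hmet' hc
  omega

theorem card_eq_of_coclass_one (hp : IsPGroup p G) (hab : HasAbelianizationTypePP p G)
    (hcc : coclass p G = 1) (hcl : Group.nilpotencyClass G = 2) :
    Nat.card G = p ^ 3 ∧ Nat.card (commutator G) = p := by
  have hpp : p.Prime := Fact.out
  obtain ⟨n, hn, hn', hcard⟩ := hab.card_eq_pow hp hcl hcc
  obtain rfl : n = 3 := by push_cast at hn'; omega
  exact ⟨hn, Nat.eq_of_mul_eq_mul_left (pow_pos hpp.pos 2) (hcard.trans (pow_succ p 2))⟩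

theorem commutator_eq_bot_of_isCoatom (hp : IsPGroup p G) (hcard : Nat.card G = p ^ 3)
    {U : Subgroup G} (hU : IsCoatom U) : ⁅U, U⁆ = ⊥ := by
  have hpp : p.Prime := Fact.out
  have h1 : Nat.card U = p ^ 2 := by
    have h := U.index_mul_card
    rw [index_eq_of_isCoatom hp hU, hcard, pow_succ'] at h
    exact Nat.eq_of_mul_eq_mul_left hpp.pos h
  rw [eq_bot_iff, commutator_le]
  intro a ha b hb
  have h2 := (IsPGroup.isMulCommutative_of_card_eq_prime_sq h1).is_comm.comm ⟨a, ha⟩ ⟨b, hb⟩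
  rw [mem_bot, commutatorElement_eq_one_iff_mul_comm]
  exact congrArg Subtype.val h2

theorem isExtraspecial_of_coclass_one (hp : IsPGroup p G) (hab : HasAbelianizationTypePP p G)
    (hcc : coclass p G = 1) (hcl : Group.nilpotencyClass G = 2) : IsExtraspecial p G := by
  have hpp : p.Prime := Fact.out
  have := hp.isNilpotent
  obtain ⟨hcard, hcom⟩ := card_eq_of_coclass_one hp hab hcc hcl
  have hle : commutator G ≤ center G := lowerCentralSeries_le_center hcl
  have hnc : ¬ IsMulCommutative G := by
    intro h
    have h1 : commutator G = ⊥ := by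
      rw [eq_bot_iff, commutator_def, commutator_le]
      intro a _ b _
      rw [mem_bot, commutatorElement_eq_one_iff_mul_comm]
      exact h.is_comm.comm a b
    rw [h1, card_bot] at hcom
    exact hpp.one_lt.ne hcom
  have hZ : Nat.card (center G) = p := by
    obtain ⟨k, hk⟩ := IsPGroup.iff_card.1 (hp.to_subgroup (center G))
    have hd : p ^ k ∣ p ^ 3 := by rw [← hk, ← hcard]; exact card_subgroup_dvd_card _
    have hk3 : k ≤ 3 := (Nat.pow_dvd_pow_iff_le_right hpp.one_lt).1 hd
    have hk1 : p ≤ p ^ k := by rw [← hk, ← hcom]; exact card_le_of_le hle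
    have hmul := (center G).index_mul_card
    rw [hk, hcard] at hmul
    -- A centre of index 1 or p has cyclic quotient, forcing G abelian; this excludes orders p³ and
    -- p².
    have hcyc : ∀ {m : ℕ}, (center G).index = m → (m = 1 ∨ m = p) → False := by
      rintro m hm (rfl | rfl)
      · rw [index_eq_one] at hm
        refine hnc ⟨⟨fun a b => ?_⟩⟩
        have ha : b ∈ center G := hm ▸ mem_top b
        exact mem_center_iff.1 ha a
      · have hm' : Nat.card (G ⧸ center G) = m := hm
        have := isCyclic_of_prime_card hm'
        exact hnc (isMulCommutative_of_isCyclic_quotient_center_self G)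
    interval_cases k
    · rw [pow_zero] at hk1
      exact absurd hk1 hpp.one_lt.not_ge
    · rw [hk, pow_one]
    · exact (hcyc rfl (Or.inr (Nat.eq_of_mul_eq_mul_right (pow_pos hpp.pos 2)
        (hmul.trans (pow_succ' p 2))))).elim
    · exact (hcyc rfl (Or.inl (Nat.eq_of_mul_eq_mul_right (pow_pos hpp.pos 3)
        (hmul.trans (one_mul _).symm)))).elim
  have heq : commutator G = center G := eq_of_le_of_card_ge hle (by rw [hZ, hcom])
  exact ⟨inferInstance, hp, hZ, heq, (hab.frattini_eq hp).trans heq⟩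

theorem exponent_of_coclass_one (hp : IsPGroup p G) (hab : HasAbelianizationTypePP p G)
    (hcc : coclass p G = 1) (hcl : Group.nilpotencyClass G = 2) :
    Monoid.exponent G = p ∨ Monoid.exponent G = p ^ 2 := by
  have hpp : p.Prime := Fact.out
  obtain ⟨hcard, hcom⟩ := card_eq_of_coclass_one hp hab hcc hcl
  have h1 : Monoid.exponent G ∣ p ^ 2 := by
    refine Monoid.exponent_dvd_of_forall_pow_eq_one fun g => ?_
    have h := pow_card_eq_one' (x := (⟨g ^ p, hab.pow_mem_commutator g⟩ : commutator G))
    rw [hcom] at h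
    rw [sq, pow_mul]
    exact congrArg Subtype.val h
  obtain ⟨k, hk, he⟩ := (Nat.dvd_prime_pow hpp).1 h1
  interval_cases k
  · rw [pow_zero, Monoid.exp_eq_one_iff] at he
    have := Nat.card_of_subsingleton (1 : G)
    rw [hcard] at this
    exact absurd this (Nat.one_lt_pow three_ne_zero hpp.one_lt).ne'
  · left; rw [he, pow_one]
  · right; exact he

theorem lastLowerCentral_bounds (hp : IsPGroup p G) (hmet : IsMetabelian G)
    (hab : HasAbelianizationTypePP p G)
    (h : (2 ≤ coclass p G ∧ Group.nilpotencyClass G = 3) ∨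
      (coclass p G = 1 ∧ Group.nilpotencyClass G = 2)) {U : Subgroup G} (hU : IsCoatom U) :
    lastLowerCentral G ≤ U ∧ ¬ lastLowerCentral G ≤ ⁅U, U⁆ := by
  have hpp : p.Prime := Fact.out
  have hle := commutator_le_of_isCoatom hp hU
  obtain ⟨hcc, hcl⟩ | ⟨hcc, hcl⟩ := h
  · obtain ⟨-, -, h1, h2⟩ := class_three_structure hp hmet hab hcc hcl
    refine ⟨?_, fun h => ?_⟩
    · rw [lastLowerCentral_eq_of_class_three hcl]
      exact (commutator_le_left _ _).trans hle
    · have h3 : p ^ 2 ≤ p := (h1.trans (card_le_of_le h)).trans (h2 U hU)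
      have := hpp.one_lt
      nlinarith
  · obtain ⟨hcard, hcom⟩ := card_eq_of_coclass_one hp hab hcc hcl
    rw [lastLowerCentral_eq_of_class_two hcl, commutator_eq_bot_of_isCoatom hp hcard hU]
    refine ⟨hle, fun h => ?_⟩
    rw [le_bot_iff.1 h, card_bot] at hcom
    exact hpp.one_lt.ne hcom

end ClassTwoAndThree

end Preliminaries

theorem mainTheorem6 (p : ℕ) [Fact p.Prime] (G : Type u) [Group G] [Finite G]
    (hp : IsPGroup p G) (hmet : IsMetabelian G) (hab : HasAbelianizationTypePP p G) :
    (2 ≤ coclass p G ∧ Group.nilpotencyClass G = 3 →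
      3 ≤ p ∧ Odd p ∧ coclass p G = 2) ∧
    (coclass p G = 1 ∧ Group.nilpotencyClass G = 2 →
      IsExtraspecial p G ∧ Nat.card G = p ^ 3 ∧
        (Monoid.exponent G = p ∨ Monoid.exponent G = p ^ 2)) ∧
    ((2 ≤ coclass p G ∧ Group.nilpotencyClass G = 3) ∨
        (coclass p G = 1 ∧ Group.nilpotencyClass G = 2) →
      {M : Subgroup G | IsCoatom M}.ncard = p + 1 ∧
      ∀ U : Fin (p + 1) → Subgroup G, EnumeratesMaximal U →
        polarizedPart (parentProjection G) U = Set.univ ∧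
        stablePart (parentProjection G) U = ∅ ∧
        ∀ i, TargetStrictlyPrecedes (parentProjection G) (U i) ∧
          KernelPrecedes (parentProjection G) (U i)) := by
  have hpp : p.Prime := Fact.out
  refine ⟨?_, ?_, ?_⟩
  · rintro ⟨hcc, hcl⟩
    obtain ⟨h3, h2, -⟩ := class_three_structure hp hmet hab hcc hcl
    exact ⟨h3, hpp.odd_of_ne_two (by omega), h2⟩
  · rintro ⟨hcc, hcl⟩
    exact ⟨isExtraspecial_of_coclass_one hp hab hcc hcl,
      (card_eq_of_coclass_one hp hab hcc hcl).1, exponent_of_coclass_one hp hab hcc hcl⟩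
  · intro h
    refine ⟨hab.ncard_isCoatom hp, fun U hU => ?_⟩
    have hker : (parentProjection G).ker = lastLowerCentral G := QuotientGroup.ker_mk' _
    have hsurj : Function.Surjective (parentProjection G) := QuotientGroup.mk'_surjective _
    have key : ∀ i, (parentProjection G).ker ≤ U i ∧
        ¬ (parentProjection G).ker ≤ ⁅U i, U i⁆ := by
      intro i
      rw [hker]
      have hi : U i ∈ {M : Subgroup G | IsCoatom M} := hU.2 ▸ Set.mem_range_self i
      exact lastLowerCentral_bounds hp hmet hab h hi
    refine ⟨Set.eq_univ_of_forall fun i => (key i).2,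
      Set.eq_empty_of_forall_notMem fun i hi => (key i).2 hi, fun i => ⟨?_, ?_⟩⟩
    · exact targetStrictlyPrecedes_of_not_ker_le (key i).1 (key i).2
    · exact kernelPrecedes_of_ker_le hsurj (key i).1
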